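/- For $x,y\in\mathbb R^n$ write $x\le y$ if $x_i\le y_i$ for all $i\in\{1,\dots,n\}$, and call a set $A\subseteq\mathbb R^n$ an antichain if it does not contain two distinct elements $x,y$ with $x\le y$. For real $s\ge 0$ and $A\subseteq\mathbb R^n$ (measurable or not) let $$\mathcal H^{s}(A)=\alpha_s\lim_{\delta\to0}\inf\Bigl\{\sum_{i\in\mathbb N}\operatorname{diam}(U_i)^s : A\subseteq\bigcup_{i\in\mathbb N}U_i,\ \operatorname{diam}(U_i)\le\delta\text{ for all } i\Bigr\},\qquad \alpha_s=\frac{\pi^{s/2}}{2^s\,\Gamma(s/2+1)},$$ be the $s$-dimensional Hausdorff (outer) measure with respect to the Euclidean metric, where $\operatorname{diam}(\emptyset)^s$ is read as $0$ for every $s\ge0$, and $\operatorname{diam}(U)^0$ as $1$ for $U\neq\emptyset$ (so $\mathcal H^0$ is the counting measure). Then for every positive integer $n$, $$\sup\bigl\{\mathcal H^{n-1}(A) : A\subseteq[0,1]^n \text{ is an antichain}\bigr\}=n .$$ -/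

import Mathlib

open MeasureTheory

/-- The normalisation factor `π^(s/2) / (2^s Γ(s/2+1))`: the volume of the `s`-dimensional Euclidean
ball of radius `1/2`. -/
noncomputable def hausdorffFactor (s : ℝ) : ℝ :=
  Real.pi ^ (s / 2) / (2 ^ s * Real.Gamma (s / 2 + 1))

/-- The `s`-dimensional Hausdorff (outer) measure of an arbitrary subset `A` of `ℝⁿ`, with Euclidean
diameters and the normalisation factor above. Mathlib's `μH[s]` is the unnormalised one: on every
set, measurable or not, it is the supremum over `δ > 0` of the infimum of `∑ diam (U i) ^ s` over
countable covers by sets of diameter at most `δ`, where empty sets contribute `0` and nonempty ones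
contribute `1` if `s = 0` (see `MeasureTheory.Measure.hausdorffMeasure_apply`). -/
noncomputable def normHausdorff {n : ℕ} (s : ℝ) (A : Set (EuclideanSpace ℝ (Fin n))) : ENNReal :=
  ENNReal.ofReal (hausdorffFactor s) * Measure.hausdorffMeasure s A

/-- The unit cube `[0,1]^n`. -/
def unitCube (n : ℕ) : Set (EuclideanSpace ℝ (Fin n)) :=
  {x | ∀ i, 0 ≤ x i ∧ x i ≤ 1}

/-- A set is an antichain if it has no two distinct elements `x`, `y` with `x i ≤ y i` for
all `i`. -/
def IsCoordAntichain {n : ℕ} (A : Set (EuclideanSpace ℝ (Fin n))) : Prop :=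
  IsAntichain (fun x y : EuclideanSpace ℝ (Fin n) => ∀ i, x i ≤ y i) A

/-! Write n = k + 1.

Upper bound. Two points of an antichain that agree outside coordinate i are comparable, so each
coordinate projection is injective on A and has image in a unit cube of volume 1. It remains to
bound the k-dimensional measure of A by the sum of its n projected volumes. For a smooth
hypersurface with unit normal ν this is the pointwise inequality 1 ≤ ∑ |ν i|. An antichain is a
Lipschitz graph in the direction (1, …, 1), so by Rademacher's theorem it splits, up to a null set,
into countably many nearly flat pieces. On these the inequality holds up to a small relative error
(`eventually_normHausdorff_image_le_sum_volume`). Since A need not be measurable, the projections of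
the pieces are summed via a measurable function of which A is almost everywhere the graph
(`tsum_volume_dropCoord_image_le_one`).

Lower bound. Nearly flat, strictly decreasing graphs over the n facets through the origin together
form an antichain, and each projects onto almost a whole facet.

Both bounds use that the normalised measure on ℝᵏ is Lebesgue measure (`normHausdorff_eq_volume`),
which rests on the isodiametric inequality and a covering by balls. -/

open scoped ENNReal

/-! ### Isodiametric inequality by Steiner symmetrization -/

section Isodiametric

variable {ι : Type*} [Fintype ι] [DecidableEq ι]

/-- The Steiner symmetrization of `A` along the `i`-th coordinate axis. -/
def steinerSymm (i : ι) (A : Set (ι → ℝ)) : Set (ι → ℝ) :=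
  {x | ENNReal.ofReal (2 * |x i|) < volume {t : ℝ | Function.update x i t ∈ A}}

omit [Fintype ι] in
theorem measurable_volume_slice (i : ι) {A : Set (ι → ℝ)} (hA : MeasurableSet A) :
    Measurable fun x : ι → ℝ => volume {t : ℝ | Function.update x i t ∈ A} := by
  have h : MeasurableSet {p : (ι → ℝ) × ℝ | Function.update p.1 i p.2 ∈ A} :=
    hA.preimage measurable_update'
  exact measurable_measure_prodMk_left h

omit [Fintype ι] in
theorem measurableSet_steinerSymm (i : ι) {A : Set (ι → ℝ)} (hA : MeasurableSet A) :
    MeasurableSet (steinerSymm i A) :=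
  measurableSet_lt (by fun_prop) (measurable_volume_slice i hA)

theorem volume_two_mul_abs_lt (m : ℝ≥0∞) :
    volume {t : ℝ | ENNReal.ofReal (2 * |t|) < m} = m := by
  rcases eq_or_ne m ∞ with rfl | hm
  · simp only [ENNReal.ofReal_lt_top, Set.ofPred_true, Real.volume_univ]
  · have : {t : ℝ | ENNReal.ofReal (2 * |t|) < m} = Metric.ball 0 (m.toReal / 2) := by
      ext t
      simp only [Set.mem_ofPred_eq, Metric.mem_ball, dist_zero_right, Real.norm_eq_abs]
      rw [ENNReal.ofReal_lt_iff_lt_toReal (by positivity) hm]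
      constructor <;> intro h <;> linarith
    rw [this, Real.volume_ball, mul_div_cancel₀ _ two_ne_zero, ENNReal.ofReal_toReal hm]

theorem volume_steinerSymm (i : ι) {A : Set (ι → ℝ)} (hA : MeasurableSet A) :
    volume (steinerSymm i A) = volume A := by
  have hS := measurableSet_steinerSymm i hA
  rw [← lintegral_indicator_one hS, ← lintegral_indicator_one hA]
  refine lintegral_eq_of_lmarginal_eq {i} (measurable_one.indicator hS)
    (measurable_one.indicator hA) ?_
  have key : ∀ (B : Set (ι → ℝ)), MeasurableSet B → ∀ x : ι → ℝ,
      (∫⋯∫⁻_{i}, B.indicator 1 ∂fun _ => volume) x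
        = volume {t : ℝ | Function.update x i t ∈ B} := by
    intro B hB x
    rw [lmarginal_singleton]
    change _ = volume (Function.update x i ⁻¹' B)
    rw [← lintegral_indicator_one (hB.preimage (measurable_update x (a := i)))]
    rfl
  funext x
  rw [key _ hS, key _ hA]
  simpa [steinerSymm] using volume_two_mul_abs_lt (volume {t : ℝ | Function.update x i t ∈ A})

/-- Each set lies between its infimum and supremum; adding sup S - inf T ≤ r and sup T - inf S ≤ r
bounds the two lengths together. -/
theorem volume_add_le_of_sub_le {S T : Set ℝ} {r : ℝ} (hS : S.Nonempty) (hT : T.Nonempty)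
    (h : ∀ s ∈ S, ∀ t ∈ T, |s - t| ≤ r) :
    volume S ≠ ∞ ∧ volume T ≠ ∞ ∧ (volume S).toReal + (volume T).toReal ≤ 2 * r := by
  obtain ⟨s₀, hs₀⟩ := hS
  obtain ⟨t₀, ht₀⟩ := hT
  have hSb : BddBelow S := ⟨t₀ - r, fun s hs => by linarith [(abs_le.1 (h s hs t₀ ht₀)).1]⟩
  have hSa : BddAbove S := ⟨t₀ + r, fun s hs => by linarith [(abs_le.1 (h s hs t₀ ht₀)).2]⟩
  have hTb : BddBelow T := ⟨s₀ - r, fun t ht => by linarith [(abs_le.1 (h s₀ hs₀ t ht)).2]⟩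
  have hTa : BddAbove T := ⟨s₀ + r, fun t ht => by linarith [(abs_le.1 (h s₀ hs₀ t ht)).1]⟩
  have e1 : sSup S ≤ sInf T + r := csSup_le ⟨s₀, hs₀⟩ fun s hs => by
    have : s - r ≤ sInf T := le_csInf ⟨t₀, ht₀⟩ fun t ht => by
      linarith [(abs_le.1 (h s hs t ht)).2]
    linarith
  have e2 : sSup T ≤ sInf S + r := csSup_le ⟨t₀, ht₀⟩ fun t ht => by
    have : t - r ≤ sInf S := le_csInf ⟨s₀, hs₀⟩ fun s hs => by
      linarith [(abs_le.1 (h s hs t ht)).1]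
    linarith
  have hS' : volume S ≤ ENNReal.ofReal (sSup S - sInf S) :=
    (measure_mono (subset_Icc_csInf_csSup hSb hSa)).trans
      (Real.volume_Icc (a := sInf S) (b := sSup S)).le
  have hT' : volume T ≤ ENNReal.ofReal (sSup T - sInf T) :=
    (measure_mono (subset_Icc_csInf_csSup hTb hTa)).trans
      (Real.volume_Icc (a := sInf T) (b := sSup T)).le
  refine ⟨ne_top_of_le_ne_top ENNReal.ofReal_ne_top hS',
    ne_top_of_le_ne_top ENNReal.ofReal_ne_top hT', ?_⟩
  have i1 : sInf S ≤ sSup S := (csInf_le hSb hs₀).trans (le_csSup hSa hs₀)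
  have i2 : sInf T ≤ sSup T := (csInf_le hTb ht₀).trans (le_csSup hTa ht₀)
  have := ENNReal.toReal_le_of_le_ofReal (by linarith) hS'
  have := ENNReal.toReal_le_of_le_ofReal (by linarith) hT'
  linarith

theorem sum_sq_sub_update (i : ι) (x y : ι → ℝ) (s t : ℝ) :
    ∑ j, (Function.update x i s j - Function.update y i t j) ^ 2
      = (s - t) ^ 2 + ∑ j ∈ Finset.univ.erase i, (x j - y j) ^ 2 := by
  rw [← Finset.add_sum_erase _ _ (Finset.mem_univ i)]
  simp only [Function.update_self]
  congr 1
  refine Finset.sum_congr rfl fun j hj => ?_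
  rw [Function.update_of_ne (Finset.ne_of_mem_erase hj),
    Function.update_of_ne (Finset.ne_of_mem_erase hj)]

/-- Slices of A through x and y contain points at most √R apart in direction i, so their lengths add
up to at most 2√R. Centred, they satisfy |x i| + |y i| ≤ √R. Sums of squares stand in for distances
because `ι → ℝ` carries the sup metric. -/
theorem sum_sq_sub_le_of_mem_steinerSymm (i : ι) {A : Set (ι → ℝ)} {d : ℝ}
    (h : ∀ x ∈ A, ∀ y ∈ A, ∑ j, (x j - y j) ^ 2 ≤ d) :
    ∀ x ∈ steinerSymm i A, ∀ y ∈ steinerSymm i A, ∑ j, (x j - y j) ^ 2 ≤ d := by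
  intro x hx y hy
  have hx' : ENNReal.ofReal (2 * |x i|) < volume {t : ℝ | Function.update x i t ∈ A} := hx
  have hy' : ENNReal.ofReal (2 * |y i|) < volume {t : ℝ | Function.update y i t ∈ A} := hy
  have nx := nonempty_of_measure_ne_zero (hx'.trans_le' zero_le).ne'
  have ny := nonempty_of_measure_ne_zero (hy'.trans_le' zero_le).ne'
  set R := d - ∑ j ∈ Finset.univ.erase i, (x j - y j) ^ 2 with hR
  have hst : ∀ s ∈ {t : ℝ | Function.update x i t ∈ A}, ∀ t ∈ {t : ℝ | Function.update y i t ∈ A},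
      |s - t| ≤ √R := by
    intro s hs t ht
    apply Real.abs_le_sqrt
    have := h _ hs _ ht
    rw [sum_sq_sub_update] at this
    linarith
  obtain ⟨fx, fy, hsum⟩ := volume_add_le_of_sub_le nx ny hst
  have ax := (ENNReal.ofReal_lt_iff_lt_toReal (by positivity) fx).1 hx'
  have ay := (ENNReal.ofReal_lt_iff_lt_toReal (by positivity) fy).1 hy'
  have hR0 : 0 ≤ R := by
    obtain ⟨s, hs⟩ := nx
    obtain ⟨t, ht⟩ := ny
    have := h _ hs _ ht
    rw [sum_sq_sub_update] at this
    nlinarith [sq_nonneg (s - t)]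
  have habs : |x i - y i| ≤ √R := by
    have := abs_sub (x i) (y i)
    linarith
  have hsq : (x i - y i) ^ 2 ≤ R := by
    rw [← sq_abs, ← Real.sq_sqrt hR0]
    gcongr
  rw [← Finset.add_sum_erase _ _ (Finset.mem_univ i)]
  linarith

omit [Fintype ι] in
theorem update_neg_mem_steinerSymm (i : ι) {A : Set (ι → ℝ)} {x : ι → ℝ}
    (hx : x ∈ steinerSymm i A) : Function.update x i (-x i) ∈ steinerSymm i A := by
  simpa [steinerSymm] using hx

-- Symmetrizing in direction i keeps a reflection symmetry already gained in direction j, so the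
-- coordinates can be treated one after another.
omit [Fintype ι] in
theorem update_neg_mem_steinerSymm_of_ne {i j : ι} (hij : j ≠ i) {A : Set (ι → ℝ)}
    (hA : ∀ x ∈ A, Function.update x j (-x j) ∈ A) {x : ι → ℝ}
    (hx : x ∈ steinerSymm i A) : Function.update x j (-x j) ∈ steinerSymm i A := by
  have hx' : ENNReal.ofReal (2 * |x i|) < volume {t : ℝ | Function.update x i t ∈ A} := hx
  change ENNReal.ofReal (2 * |Function.update x j (-x j) i|) < _
  rw [Function.update_of_ne hij.symm]
  refine hx'.trans_le (measure_mono fun t ht => ?_)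
  have := hA _ ht
  rw [Function.update_of_ne hij, Function.update_comm hij.symm] at this
  exact this

theorem exists_symmetric_of_sum_sq_sub_le {A : Set (ι → ℝ)} (hA : MeasurableSet A) {d : ℝ}
    (h : ∀ x ∈ A, ∀ y ∈ A, ∑ j, (x j - y j) ^ 2 ≤ d) (s : Finset ι) :
    ∃ B : Set (ι → ℝ), MeasurableSet B ∧ volume B = volume A ∧
      (∀ x ∈ B, ∀ y ∈ B, ∑ j, (x j - y j) ^ 2 ≤ d) ∧
      ∀ i ∈ s, ∀ x ∈ B, Function.update x i (-x i) ∈ B := by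
  induction s using Finset.induction_on with
  | empty => exact ⟨A, hA, rfl, h, by simp⟩
  | insert i s hi ih =>
    obtain ⟨B, hB, hv, hd, hs⟩ := ih
    refine ⟨steinerSymm i B, measurableSet_steinerSymm i hB, by rw [volume_steinerSymm i hB, hv],
      sum_sq_sub_le_of_mem_steinerSymm i hd, fun j hj x hx => ?_⟩
    rcases eq_or_ne j i with rfl | hne
    · exact update_neg_mem_steinerSymm _ hx
    · exact update_neg_mem_steinerSymm_of_ne hne
        (hs j ((Finset.mem_insert.1 hj).resolve_left hne)) hx

theorem neg_mem_of_update_neg_mem {B : Set (ι → ℝ)}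
    (hB : ∀ i, ∀ x ∈ B, Function.update x i (-x i) ∈ B) {x : ι → ℝ} (hx : x ∈ B) : -x ∈ B := by
  have key : ∀ s : Finset ι, (fun j => if j ∈ s then -x j else x j) ∈ B := by
    intro s
    induction s using Finset.induction_on with
    | empty => simpa using hx
    | insert i s hi ih =>
      convert hB i _ ih using 1
      funext j
      rcases eq_or_ne j i with rfl | hne
      · simp [hi]
      · simp [hne]
  simpa [Pi.neg_def] using key Finset.univ

/-- **Isodiametric inequality**: a bounded Euclidean set of diameter `d` has at most the volume of
a ball of radius `d / 2`. -/
theorem volume_le_volume_closedBall_half_diam {U : Set (EuclideanSpace ℝ ι)}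
    (hU : Bornology.IsBounded U) :
    volume U ≤ volume (Metric.closedBall (0 : EuclideanSpace ℝ ι) (Metric.diam U / 2)) := by
  set d := Metric.diam U with hd
  have hmp := PiLp.volume_preserving_toLp ι
  have hclosed : MeasurableSet (closure U) := isClosed_closure.measurableSet
  set A : Set (ι → ℝ) := WithLp.toLp 2 ⁻¹' closure U with hA
  have hAm : MeasurableSet A := hmp.measurable hclosed
  have hAd : ∀ x ∈ A, ∀ y ∈ A, ∑ j, (x j - y j) ^ 2 ≤ d ^ 2 := by
    intro x hx y hy
    have := Metric.dist_le_diam_of_mem hU.closure hx hy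
    rw [Metric.diam_closure, EuclideanSpace.dist_eq] at this
    have := (Real.sqrt_le_left Metric.diam_nonneg).1 this
    simpa [Real.dist_eq, sq_abs] using this
  obtain ⟨B, hBm, hBv, hBd, hBs⟩ := exists_symmetric_of_sum_sq_sub_le hAm hAd Finset.univ
  calc volume U ≤ volume (closure U) := measure_mono subset_closure
    _ = volume A := (hmp.measure_preimage hclosed.nullMeasurableSet).symm
    _ = volume B := hBv.symm
    _ ≤ volume (WithLp.toLp 2 ⁻¹' Metric.closedBall (0 : EuclideanSpace ℝ ι) (d / 2)) := by
        refine measure_mono fun x hx => ?_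
        -- By central symmetry the diameter bound applies to x and -x, giving 2|x| ≤ d.
        have h := hBd x hx (-x) (neg_mem_of_update_neg_mem (fun i => hBs i (Finset.mem_univ i)) hx)
        have h' : ∑ j, x j ^ 2 ≤ (d / 2) ^ 2 := by
          have : ∀ j, (x j - (-x) j) ^ 2 = 4 * x j ^ 2 := fun j => by simp; ring
          simp only [this, ← Finset.mul_sum] at h
          linarith
        rw [Set.mem_preimage, mem_closedBall_zero_iff, EuclideanSpace.norm_eq]
        refine Real.sqrt_le_iff.2 ⟨by have : 0 ≤ d := Metric.diam_nonneg; positivity, ?_⟩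
        simpa [sq_abs] using h'
    _ = _ := hmp.measure_preimage Metric.isClosed_closedBall.measurableSet.nullMeasurableSet

end Isodiametric

/-! ### Normalised Hausdorff measure on ℝᵏ is Lebesgue measure -/

theorem hausdorffFactor_pos (k : ℕ) : 0 < hausdorffFactor k := by
  unfold hausdorffFactor
  have : 0 < Real.Gamma ((k : ℝ) / 2 + 1) := Real.Gamma_pos_of_pos (by positivity)
  positivity

theorem hausdorffFactor_zero : hausdorffFactor 0 = 1 := by
  simp [hausdorffFactor]

theorem volume_closedBall_eq_hausdorffFactor_mul {k : ℕ} (x : EuclideanSpace ℝ (Fin k)) {r : ℝ}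
    (hr : 0 ≤ r) :
    volume (Metric.closedBall x r)
      = ENNReal.ofReal (hausdorffFactor k) * ENNReal.ofReal (2 * r) ^ k := by
  rcases k.eq_zero_or_pos with rfl | hk
  · have : Metric.closedBall x r = {0} := by
      ext y
      simp [Subsingleton.elim y x, hr, Subsingleton.elim x 0]
    have h : WithLp.toLp 2 ⁻¹' ({0} : Set (EuclideanSpace ℝ (Fin 0)))
        = Set.univ.pi fun _ => Set.univ := by
      ext y
      simp [Subsingleton.elim (WithLp.toLp 2 y) 0]
    rw [this, ← (PiLp.volume_preserving_toLp (Fin 0)).measure_preimage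
      (measurableSet_singleton 0).nullMeasurableSet, h, volume_pi_pi]
    simp [hausdorffFactor_zero]
  · have : Nonempty (Fin k) := ⟨⟨0, hk⟩⟩
    rw [EuclideanSpace.volume_closedBall, Fintype.card_fin, mul_comm, ENNReal.ofReal_mul two_pos.le,
      mul_pow, ← mul_assoc]
    congr 1
    rw [← ENNReal.ofReal_pow two_pos.le, ← ENNReal.ofReal_mul (hausdorffFactor_pos k).le]
    congr 1
    unfold hausdorffFactor
    have e : Real.pi ^ ((k : ℝ) / 2) = √Real.pi ^ k := by
      rw [Real.sqrt_eq_rpow, ← Real.rpow_natCast, ← Real.rpow_mul Real.pi_pos.le]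
      ring_nf
    rw [e, Real.rpow_natCast]
    have : 0 < Real.Gamma ((k : ℝ) / 2 + 1) := Real.Gamma_pos_of_pos (by positivity)
    field_simp

theorem volume_le_hausdorffFactor_mul_ediam_pow {k : ℕ} (U : Set (EuclideanSpace ℝ (Fin k)))
    (hU : Metric.ediam U ≠ ∞) :
    volume U ≤ ENNReal.ofReal (hausdorffFactor k) * Metric.ediam U ^ k := by
  have hb : Bornology.IsBounded U := Metric.isBounded_iff_ediam_ne_top.2 hU
  refine (volume_le_volume_closedBall_half_diam hb).trans_eq ?_
  rw [volume_closedBall_eq_hausdorffFactor_mul _ (by have := Metric.diam_nonneg (s := U); positivity),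
    mul_div_cancel₀ _ two_ne_zero, Metric.diam, ENNReal.ofReal_toReal hU]

/-- The isodiametric inequality compares volume with diam ^ k on every set of diameter at most 1,
and such a comparison on small sets passes to the Hausdorff measure. -/
theorem volume_le_normHausdorff {k : ℕ} (S : Set (EuclideanSpace ℝ (Fin k))) :
    volume S ≤ normHausdorff k S := by
  set c := ENNReal.ofReal (hausdorffFactor k) with hc
  have hc0 : c ≠ 0 := (ENNReal.ofReal_pos.2 (hausdorffFactor_pos k)).ne'
  have hct : c ≠ ∞ := ENNReal.ofReal_ne_top
  have h : (c⁻¹ • volume : Measure (EuclideanSpace ℝ (Fin k))) ≤ Measure.hausdorffMeasure k := by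
    refine Measure.le_hausdorffMeasure _ _ 1 one_pos fun s hs => ?_
    rw [Measure.smul_apply, smul_eq_mul, ENNReal.inv_mul_le_iff hc0 hct, ENNReal.rpow_natCast]
    exact volume_le_hausdorffFactor_mul_ediam_pow s (ne_top_of_le_ne_top ENNReal.one_ne_top hs)
  have := h S
  rwa [Measure.smul_apply, smul_eq_mul, ENNReal.inv_mul_le_iff hc0 hct] at this

theorem exists_hausdorffMeasure_eq_smul_volume (k : ℕ) :
    ∃ a : NNReal, (Measure.hausdorffMeasure k : Measure (EuclideanSpace ℝ (Fin k)))
      = (a : ℝ≥0∞) • volume := by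
  have : (Measure.hausdorffMeasure k : Measure (EuclideanSpace ℝ (Fin k))).IsAddHaarMeasure := by
    simpa using isAddHaarMeasure_hausdorffMeasure (E := EuclideanSpace ℝ (Fin k))
  exact ⟨_, Measure.isAddLeftInvariant_eq_smul _ _⟩

theorem hausdorffMeasure_absolutelyContinuous (k : ℕ) :
    (Measure.hausdorffMeasure k : Measure (EuclideanSpace ℝ (Fin k))) ≪ volume := by
  obtain ⟨a, ha⟩ := exists_hausdorffMeasure_eq_smul_volume k
  rw [ha]
  exact Measure.smul_absolutelyContinuous

theorem ediam_closedBall_le {X : Type*} [PseudoMetricSpace X] (x : X) {r : ℝ} (hr : 0 ≤ r) :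
    Metric.ediam (Metric.closedBall x r) ≤ ENNReal.ofReal (2 * r) := by
  rw [← Metric.closedEBall_ofReal hr, ENNReal.ofReal_mul two_pos.le, ENNReal.ofReal_ofNat]
  exact Metric.ediam_closedEBall_le

/-- Disjoint small closed balls fill the unit ball up to a null set, and for balls the isodiametric
inequality is an equality. One test set suffices later, both measures being proportional. -/
theorem normHausdorff_ball_le {k : ℕ} :
    normHausdorff k (Metric.ball (0 : EuclideanSpace ℝ (Fin k)) 1)
      ≤ volume (Metric.ball (0 : EuclideanSpace ℝ (Fin k)) 1) := by
  set s := Metric.ball (0 : EuclideanSpace ℝ (Fin k)) 1 with hs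
  set c := ENNReal.ofReal (hausdorffFactor k) with hc
  have hc0 : c ≠ 0 := (ENNReal.ofReal_pos.2 (hausdorffFactor_pos k)).ne'
  have hct : c ≠ ∞ := ENNReal.ofReal_ne_top
  have cov : ∀ m : ℕ, ∃ (t : Set (EuclideanSpace ℝ (Fin k))) (r : EuclideanSpace ℝ (Fin k) → ℝ),
      t.Countable ∧ t ⊆ s ∧
      (∀ x ∈ t, r x ∈ {ρ | Metric.closedBall x ρ ⊆ s} ∩ Set.Ioo 0 (1 / ((m : ℝ) + 1))) ∧
      volume (s \ ⋃ x ∈ t, Metric.closedBall x (r x)) = 0 ∧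
      t.PairwiseDisjoint fun x => Metric.closedBall x (r x) := by
    intro m
    refine Besicovitch.exists_disjoint_closedBall_covering_ae volume
      (fun x => {ρ | Metric.closedBall x ρ ⊆ s}) s ?_ (fun _ => 1 / ((m : ℝ) + 1))
      (fun _ _ => by positivity)
    intro x hx δ hδ
    obtain ⟨ε, hε, hball⟩ := Metric.isOpen_ball.mem_nhds hx |> Metric.mem_nhds_iff.1
    refine ⟨min ε δ / 2, (Metric.closedBall_subset_ball ?_).trans hball, ?_, ?_⟩
    · have := min_le_left ε δ
      have : 0 < min ε δ := lt_min hε hδ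
      linarith
    · have : 0 < min ε δ := lt_min hε hδ
      positivity
    · have := min_le_right ε δ
      have : 0 < min ε δ := lt_min hε hδ
      linarith
  choose t r htc hts htr hnull hdisj using cov
  -- Removing the leftovers of all scales at once leaves one set that is covered at every scale.
  set N := ⋃ m, s \ ⋃ x ∈ t m, Metric.closedBall x (r m x) with hN
  have hN0 : volume N = 0 := measure_iUnion_null hnull
  have hHN : Measure.hausdorffMeasure (k : ℝ) N = 0 := hausdorffMeasure_absolutelyContinuous k hN0
  have hH : Measure.hausdorffMeasure (k : ℝ) s = Measure.hausdorffMeasure (k : ℝ) (s \ N) :=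
    (measure_sdiff_null hHN).symm
  have hcnt : ∀ m, Countable (t m) := fun m => (htc m).to_subtype
  have hvol : ∀ m, ∑' x : t m,
      Metric.ediam (Metric.closedBall (x : EuclideanSpace ℝ (Fin k)) (r m x)) ^ (k : ℝ)
      ≤ c⁻¹ * volume s := by
    intro m
    calc _ ≤ ∑' x : t m,
            c⁻¹ * volume (Metric.closedBall (x : EuclideanSpace ℝ (Fin k)) (r m x)) := by
          refine ENNReal.tsum_le_tsum fun x => ?_
          have hr0 : 0 ≤ r m x := (htr m x x.2).2.1.le
          rw [volume_closedBall_eq_hausdorffFactor_mul _ hr0, ← mul_assoc,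
            ENNReal.inv_mul_cancel hc0 hct, one_mul, ENNReal.rpow_natCast]
          gcongr
          exact ediam_closedBall_le _ hr0
      _ = c⁻¹ * volume (⋃ x ∈ t m, Metric.closedBall x (r m x)) := by
          rw [ENNReal.tsum_mul_left, measure_biUnion (htc m) (hdisj m)
            fun x _ => Metric.isClosed_closedBall.measurableSet]
      _ ≤ c⁻¹ * volume s := by
          gcongr
          exact Set.iUnion₂_subset fun x hx => (htr m x hx).1
  have hle : Measure.hausdorffMeasure (k : ℝ) (s \ N) ≤ c⁻¹ * volume s := by
    refine (Measure.hausdorffMeasure_le_liminf_tsum (k : ℝ) (s \ N) (l := Filter.atTop)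
      (fun m : ℕ => ENNReal.ofReal (2 * (1 / ((m : ℝ) + 1)))) ?_
      (fun m (x : t m) => Metric.closedBall (x : EuclideanSpace ℝ (Fin k)) (r m x)) ?_ ?_).trans ?_
    · rw [← ENNReal.ofReal_zero]
      refine ENNReal.tendsto_ofReal ?_
      simpa using (tendsto_one_div_add_atTop_nhds_zero_nat (𝕜 := ℝ)).const_mul 2
    · refine Filter.Eventually.of_forall fun m x => ?_
      refine (ediam_closedBall_le _ (htr m x x.2).2.1.le).trans ?_
      have := (htr m x x.2).2.2
      gcongr
    · refine Filter.Eventually.of_forall fun m x hx => ?_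
      by_contra hcon
      refine hx.2 (Set.mem_iUnion.2 ⟨m, hx.1, fun h => hcon ?_⟩)
      obtain ⟨y, hy, hxy⟩ := Set.mem_iUnion₂.1 h
      exact Set.mem_iUnion.2 ⟨⟨y, hy⟩, hxy⟩
    · refine (Filter.liminf_le_liminf (Filter.Eventually.of_forall hvol)).trans_eq ?_
      exact Filter.liminf_const _
  unfold normHausdorff
  rw [hH]
  calc _ ≤ c * (c⁻¹ * volume s) := by gcongr
    _ = volume s := by rw [← mul_assoc, ENNReal.mul_inv_cancel hc0 hct, one_mul]

/-- On `ℝᵏ`, the normalised `k`-dimensional Hausdorff measure is the Lebesgue measure. -/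
theorem normHausdorff_eq_volume {k : ℕ} (S : Set (EuclideanSpace ℝ (Fin k))) :
    normHausdorff k S = volume S := by
  refine le_antisymm ?_ (volume_le_normHausdorff S)
  obtain ⟨a, ha⟩ := exists_hausdorffMeasure_eq_smul_volume k
  have h := normHausdorff_ball_le (k := k)
  have b0 : volume (Metric.ball (0 : EuclideanSpace ℝ (Fin k)) 1) ≠ 0 :=
    (Metric.measure_ball_pos volume _ one_pos).ne'
  have bt : volume (Metric.ball (0 : EuclideanSpace ℝ (Fin k)) 1) ≠ ∞ := measure_ball_lt_top.ne
  unfold normHausdorff at h ⊢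
  rw [ha, Measure.smul_apply, smul_eq_mul, ← mul_assoc] at h ⊢
  have h1 : ENNReal.ofReal (hausdorffFactor k) * a ≤ 1 := by
    rwa [← ENNReal.mul_le_mul_iff_left b0 bt, one_mul]
  calc _ ≤ 1 * volume S := by gcongr
    _ = volume S := one_mul _

/-! ### Measure-theoretic rules for the normalised measure -/

section NormHausdorff

variable {m n : ℕ}

theorem normHausdorff_mono (s : ℝ) {A B : Set (EuclideanSpace ℝ (Fin n))} (h : A ⊆ B) :
    normHausdorff s A ≤ normHausdorff s B := by
  unfold normHausdorff
  gcongr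

theorem normHausdorff_union_le (s : ℝ) (A B : Set (EuclideanSpace ℝ (Fin n))) :
    normHausdorff s (A ∪ B) ≤ normHausdorff s A + normHausdorff s B := by
  unfold normHausdorff
  rw [← mul_add]
  gcongr
  exact measure_union_le _ _

theorem normHausdorff_iUnion_le (s : ℝ) (A : ℕ → Set (EuclideanSpace ℝ (Fin n))) :
    normHausdorff s (⋃ i, A i) ≤ ∑' i, normHausdorff s (A i) := by
  unfold normHausdorff
  rw [ENNReal.tsum_mul_left]
  gcongr
  exact measure_iUnion_le _

theorem normHausdorff_iUnion (s : ℝ) {ι : Type*} [Fintype ι]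
    {A : ι → Set (EuclideanSpace ℝ (Fin n))} (hA : ∀ i, MeasurableSet (A i))
    (hd : Pairwise (Function.onFun Disjoint A)) :
    normHausdorff s (⋃ i, A i) = ∑ i, normHausdorff s (A i) := by
  unfold normHausdorff
  rw [measure_iUnion hd hA, tsum_fintype, Finset.mul_sum]

theorem normHausdorff_image_le {s : ℝ} (hs : 0 ≤ s) {K : NNReal}
    {f : EuclideanSpace ℝ (Fin m) → EuclideanSpace ℝ (Fin n)} {A : Set (EuclideanSpace ℝ (Fin m))}
    (hf : LipschitzOnWith K f A) :
    normHausdorff s (f '' A) ≤ (K : ℝ≥0∞) ^ s * normHausdorff s A := by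
  unfold normHausdorff
  rw [mul_left_comm]
  gcongr
  exact hf.hausdorffMeasure_image_le hs

theorem normHausdorff_isometry_image {s : ℝ} (hs : 0 ≤ s)
    {f : EuclideanSpace ℝ (Fin m) → EuclideanSpace ℝ (Fin n)} (hf : Isometry f)
    (A : Set (EuclideanSpace ℝ (Fin m))) :
    normHausdorff s (f '' A) = normHausdorff s A := by
  unfold normHausdorff
  rw [hf.hausdorffMeasure_image (Or.inl hs)]

end NormHausdorff

/-! ### Coordinate projections -/

section DropCoord

variable {k : ℕ}

/-- The projection `ℝᵏ⁺¹ → ℝᵏ` forgetting the `i`-th coordinate. -/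
noncomputable def dropCoord (i : Fin (k + 1)) :
    EuclideanSpace ℝ (Fin (k + 1)) →L[ℝ] EuclideanSpace ℝ (Fin k) :=
  LinearMap.toContinuousLinearMap
    { toFun := fun x => WithLp.toLp 2 fun j => x (i.succAbove j)
      map_add' := fun x y => by ext j; simp
      map_smul' := fun c x => by ext j; simp }

@[simp]
theorem dropCoord_apply (i : Fin (k + 1)) (x : EuclideanSpace ℝ (Fin (k + 1))) (j : Fin k) :
    dropCoord i x j = x (i.succAbove j) := rfl

theorem norm_dropCoord_le (i : Fin (k + 1)) (x : EuclideanSpace ℝ (Fin (k + 1))) :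
    ‖dropCoord i x‖ ≤ ‖x‖ := by
  rw [EuclideanSpace.norm_eq, EuclideanSpace.norm_eq]
  refine Real.sqrt_le_sqrt ?_
  rw [Fin.sum_univ_succAbove _ i]
  simp only [dropCoord_apply]
  nlinarith [sq_nonneg ‖x i‖]

theorem lipschitzWith_dropCoord (i : Fin (k + 1)) : LipschitzWith 1 (dropCoord i) :=
  LipschitzWith.of_dist_le_mul fun x y => by
    rw [dist_eq_norm, dist_eq_norm, ← map_sub, NNReal.coe_one, one_mul]
    exact norm_dropCoord_le i _

theorem volume_dropCoord_image_le_normHausdorff (i : Fin (k + 1))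
    (A : Set (EuclideanSpace ℝ (Fin (k + 1)))) :
    volume (dropCoord i '' A) ≤ normHausdorff k A := by
  rw [← normHausdorff_eq_volume]
  simpa using normHausdorff_image_le (Nat.cast_nonneg k) (lipschitzWith_dropCoord i).lipschitzOnWith

theorem measurableSet_setOf_forall_mem {m n : ℕ} (f : Fin m → Fin n) {s : Set ℝ}
    (hs : MeasurableSet s) :
    MeasurableSet {z : EuclideanSpace ℝ (Fin n) | ∀ j, z (f j) ∈ s} := by
  have : {z : EuclideanSpace ℝ (Fin n) | ∀ j, z (f j) ∈ s} = ⋂ j, (fun z => z (f j)) ⁻¹' s := by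
    ext; simp
  rw [this]
  exact MeasurableSet.iInter fun j => hs.preimage (by fun_prop)

theorem volume_setOf_forall_mem (s : Set ℝ) (hs : MeasurableSet s) :
    volume {z : EuclideanSpace ℝ (Fin k) | ∀ j, z j ∈ s} = volume s ^ k := by
  have hm : MeasurableSet {z : EuclideanSpace ℝ (Fin k) | ∀ j, z j ∈ s} :=
    measurableSet_setOf_forall_mem id hs
  rw [← (PiLp.volume_preserving_toLp (Fin k)).measure_preimage hm.nullMeasurableSet]
  have : WithLp.toLp 2 ⁻¹' {z : EuclideanSpace ℝ (Fin k) | ∀ j, z j ∈ s}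
      = Set.univ.pi fun _ => s := by
    ext; simp
  rw [this, volume_pi_pi]
  simp

end DropCoord

/-! ### Lower bound: graphs over the facets -/

section LowerBound

variable {k : ℕ}

/-- A strictly decreasing graph of height at most `ε` over the facet `{x i = 0}` of the unit
cube. -/
def facetGraph (k : ℕ) (ε : ℝ) (i : Fin (k + 1)) : Set (EuclideanSpace ℝ (Fin (k + 1))) :=
  {x | (∀ j, x (i.succAbove j) ∈ Set.Ioc ε 1) ∧
    x i = ε * (1 - (∑ j, x (i.succAbove j)) / (k + 1))}

theorem measurableSet_facetGraph (ε : ℝ) (i : Fin (k + 1)) : MeasurableSet (facetGraph k ε i) := by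
  have h2 : MeasurableSet {x : EuclideanSpace ℝ (Fin (k + 1)) |
      x i = ε * (1 - (∑ j, x (i.succAbove j)) / (k + 1))} :=
    measurableSet_eq_fun (by fun_prop) (by fun_prop)
  exact (measurableSet_setOf_forall_mem i.succAbove measurableSet_Ioc).inter h2

theorem mem_Icc_of_mem_facetGraph {ε : ℝ} (hε : 0 < ε) {i : Fin (k + 1)}
    {x : EuclideanSpace ℝ (Fin (k + 1))} (hx : x ∈ facetGraph k ε i) : x i ∈ Set.Icc 0 ε := by
  obtain ⟨h1, h2⟩ := hx
  have hs0 : 0 ≤ ∑ j, x (i.succAbove j) := Finset.sum_nonneg fun j _ => hε.le.trans (h1 j).1.le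
  have hs1 : ∑ j, x (i.succAbove j) ≤ k := by
    simpa using Finset.sum_le_sum fun j (_ : j ∈ Finset.univ) => (h1 j).2
  have hq0 : 0 ≤ (∑ j, x (i.succAbove j)) / ((k : ℝ) + 1) := by positivity
  have hq1 : (∑ j, x (i.succAbove j)) / ((k : ℝ) + 1) ≤ 1 := by
    rw [div_le_one (by positivity)]
    linarith
  rw [h2]
  constructor <;> nlinarith

theorem lt_of_mem_facetGraph {ε : ℝ} {i j : Fin (k + 1)} (hij : j ≠ i)
    {x : EuclideanSpace ℝ (Fin (k + 1))} (hx : x ∈ facetGraph k ε i) : x j ∈ Set.Ioc ε 1 := by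
  obtain ⟨l, rfl⟩ := Fin.exists_succAbove_eq hij
  exact hx.1 l

theorem facetGraph_subset_unitCube {ε : ℝ} (hε : 0 < ε) (hε1 : ε < 1) (i : Fin (k + 1)) :
    facetGraph k ε i ⊆ unitCube (k + 1) := by
  intro x hx j
  rcases eq_or_ne j i with rfl | hne
  · have := mem_Icc_of_mem_facetGraph hε hx
    exact ⟨this.1, this.2.trans hε1.le⟩
  · have := lt_of_mem_facetGraph hne hx
    exact ⟨hε.le.trans this.1.le, this.2⟩

/-- Within one graph the height strictly decreases in the sum of the other coordinates, so x ≤ y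
forces equality. Between graphs i ≠ i', coordinate i' exceeds ε on the first and is at most ε on the
second; hence the base `Set.Ioc ε 1`. -/
theorem isCoordAntichain_iUnion_facetGraph {ε : ℝ} (hε : 0 < ε) :
    IsCoordAntichain (⋃ i, facetGraph k ε i) := by
  intro x hx y hy hxy hle
  obtain ⟨i, hi⟩ := Set.mem_iUnion.1 hx
  obtain ⟨i', hi'⟩ := Set.mem_iUnion.1 hy
  rcases eq_or_ne i' i with rfl | hne
  · apply hxy
    have hsum : ∑ j, x (i'.succAbove j) ≤ ∑ j, y (i'.succAbove j) :=
      Finset.sum_le_sum fun j _ => hle _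
    have heq : ∑ j, x (i'.succAbove j) = ∑ j, y (i'.succAbove j) := by
      refine le_antisymm hsum ?_
      have h := hle i'
      rw [hi.2, hi'.2] at h
      have h1 := le_of_mul_le_mul_left h hε
      have h2 : (∑ j, y (i'.succAbove j)) / ((k : ℝ) + 1)
          ≤ (∑ j, x (i'.succAbove j)) / ((k : ℝ) + 1) := by linarith
      exact (div_le_div_iff_of_pos_right (by positivity)).1 h2
    have hall := (Finset.sum_eq_sum_iff_of_le fun j (_ : j ∈ Finset.univ) =>
      hle (i'.succAbove j)).1 heq
    ext j
    rcases eq_or_ne j i' with rfl | hj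
    · rw [hi.2, hi'.2, heq]
    · obtain ⟨l, rfl⟩ := Fin.exists_succAbove_eq hj
      exact hall l (Finset.mem_univ l)
  · have h1 := (lt_of_mem_facetGraph hne hi).1
    have h2 := (mem_Icc_of_mem_facetGraph hε hi').2
    linarith [hle i']

theorem pairwise_disjoint_facetGraph {ε : ℝ} (hε : 0 < ε) :
    Pairwise (Function.onFun Disjoint (facetGraph k ε)) := by
  intro i j hij
  refine Set.disjoint_left.2 fun x hi hj => ?_
  have h1 := (mem_Icc_of_mem_facetGraph hε hi).2
  have h2 := (lt_of_mem_facetGraph hij hj).1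
  linarith

theorem le_normHausdorff_facetGraph (ε : ℝ) (i : Fin (k + 1)) :
    ENNReal.ofReal (1 - ε) ^ k ≤ normHausdorff k (facetGraph k ε i) := by
  refine le_trans ?_ (volume_dropCoord_image_le_normHausdorff i _)
  rw [← Real.volume_Ioc, ← volume_setOf_forall_mem _ measurableSet_Ioc]
  refine measure_mono fun z hz => ?_
  refine ⟨WithLp.toLp 2 (i.insertNth (ε * (1 - (∑ j, z j) / (k + 1))) z), ⟨fun j => ?_, ?_⟩, ?_⟩
  · simpa using hz j
  · simp
  · ext j
    simp

theorem le_normHausdorff_iUnion_facetGraph {ε : ℝ} (hε : 0 < ε) :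
    (k + 1) * ENNReal.ofReal (1 - ε) ^ k ≤ normHausdorff k (⋃ i, facetGraph k ε i) := by
  rw [normHausdorff_iUnion _ (measurableSet_facetGraph ε) (pairwise_disjoint_facetGraph hε)]
  refine le_trans ?_ (Finset.sum_le_sum fun i _ => le_normHausdorff_facetGraph ε i)
  simp

end LowerBound

/-! ### Antichains as Lipschitz graphs along the diagonal -/

section AntichainChart

variable {k : ℕ}

/-- The coordinate differences `x (j + 1) - x 0`: the projection of `ℝᵏ⁺¹` along `(1, …, 1)`. -/
noncomputable def diagProj (k : ℕ) :
    EuclideanSpace ℝ (Fin (k + 1)) →L[ℝ] EuclideanSpace ℝ (Fin k) :=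
  LinearMap.toContinuousLinearMap
    { toFun := fun x => WithLp.toLp 2 fun j => x j.succ - x 0
      map_add' := fun x y => by ext j; simp; ring
      map_smul' := fun c x => by ext j; simp; ring }

@[simp]
theorem diagProj_apply (x : EuclideanSpace ℝ (Fin (k + 1))) (j : Fin k) :
    diagProj k x j = x j.succ - x 0 := rfl

/-- The section of `diagProj` with vanishing `0`-th coordinate. -/
noncomputable def diagSection (k : ℕ) :
    EuclideanSpace ℝ (Fin k) →L[ℝ] EuclideanSpace ℝ (Fin (k + 1)) :=
  LinearMap.toContinuousLinearMap
    { toFun := fun y => WithLp.toLp 2 (Fin.cons 0 y)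
      map_add' := fun x y => by ext j; refine Fin.cases ?_ (fun j => ?_) j <;> simp
      map_smul' := fun c x => by ext j; refine Fin.cases ?_ (fun j => ?_) j <;> simp }

@[simp]
theorem diagSection_apply_zero (y : EuclideanSpace ℝ (Fin k)) : diagSection k y 0 = 0 := rfl

@[simp]
theorem diagSection_apply_succ (y : EuclideanSpace ℝ (Fin k)) (j : Fin k) :
    diagSection k y j.succ = y j := rfl

/-- The graph map of `g` over the hyperplane `{x 0 = 0}` in the direction `(1, …, 1)`. -/
noncomputable def diagGraph (g : EuclideanSpace ℝ (Fin k) → ℝ) (y : EuclideanSpace ℝ (Fin k)) :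
    EuclideanSpace ℝ (Fin (k + 1)) :=
  g y • WithLp.toLp 2 (fun _ => (1 : ℝ)) + diagSection k y

theorem diagProj_diagGraph (g : EuclideanSpace ℝ (Fin k) → ℝ) (y : EuclideanSpace ℝ (Fin k)) :
    diagProj k (diagGraph g y) = y := by
  ext j
  simp [diagGraph]

theorem diagGraph_diagProj {g : EuclideanSpace ℝ (Fin k) → ℝ}
    {x : EuclideanSpace ℝ (Fin (k + 1))} (h : g (diagProj k x) = x 0) :
    diagGraph g (diagProj k x) = x := by
  ext j
  refine Fin.cases ?_ (fun j => ?_) j <;> simp [diagGraph, h]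

theorem exists_lipschitzWith_diagGraph {g : EuclideanSpace ℝ (Fin k) → ℝ} (hg : LipschitzWith 1 g) :
    ∃ C, LipschitzWith C (diagGraph g) := by
  have h : LipschitzWith ‖(WithLp.toLp 2 (fun _ => 1) : EuclideanSpace ℝ (Fin (k + 1)))‖₊
      fun t : ℝ => t • (WithLp.toLp 2 (fun _ => 1) : EuclideanSpace ℝ (Fin (k + 1))) := by
    refine LipschitzWith.of_dist_le_mul fun s t => ?_
    rw [dist_eq_norm, ← sub_smul, norm_smul, mul_comm, coe_nnnorm, ← dist_eq_norm]
  exact ⟨_, (h.comp hg).add (diagSection k).lipschitz⟩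

/-- If x 0 - y 0 exceeded every change in the differences x j - x 0, all coordinates of x would
dominate those of y. -/
theorem sub_le_norm_diagProj_sub {A : Set (EuclideanSpace ℝ (Fin (k + 1)))}
    (hA : IsCoordAntichain A) {x y : EuclideanSpace ℝ (Fin (k + 1))} (hx : x ∈ A) (hy : y ∈ A) :
    x 0 - y 0 ≤ ‖diagProj k x - diagProj k y‖ := by
  by_contra! h
  have hpos : 0 < x 0 - y 0 := (norm_nonneg _).trans_lt h
  have hle : ∀ i, y i ≤ x i := by
    intro i
    refine Fin.cases (by linarith) (fun j => ?_) i
    have h1 := (PiLp.norm_apply_le (diagProj k x - diagProj k y) j).trans_lt h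
    rw [Real.norm_eq_abs] at h1
    have h2 := (abs_lt.1 h1).1
    simp only [PiLp.sub_apply, diagProj_apply] at h2
    linarith
  have hne : y ≠ x := by
    rintro rfl
    simp at hpos
  exact hA hy hx hne hle

/-- An antichain is a Lipschitz graph in the direction `(1, …, 1)`. -/
theorem exists_lipschitzWith_diagProj_eq {A : Set (EuclideanSpace ℝ (Fin (k + 1)))}
    (hA : IsCoordAntichain A) :
    ∃ g : EuclideanSpace ℝ (Fin k) → ℝ, LipschitzWith 1 g ∧ ∀ x ∈ A, g (diagProj k x) = x 0 := by
  have habs : ∀ x ∈ A, ∀ y ∈ A, |x 0 - y 0| ≤ ‖diagProj k x - diagProj k y‖ := by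
    intro x hx y hy
    refine abs_sub_le_iff.2 ⟨sub_le_norm_diagProj_sub hA hx hy, ?_⟩
    rw [norm_sub_rev]
    exact sub_le_norm_diagProj_sub hA hy hx
  let q := Function.invFunOn (diagProj k) A
  have hq : ∀ y ∈ diagProj k '' A, q y ∈ A ∧ diagProj k (q y) = y := fun y hy =>
    ⟨Function.invFunOn_mem hy, Function.invFunOn_eq hy⟩
  have hlip : LipschitzOnWith 1 (fun y => q y 0) (diagProj k '' A) := by
    refine LipschitzOnWith.of_dist_le_mul fun y hy z hz => ?_
    have := habs _ (hq y hy).1 _ (hq z hz).1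
    rw [(hq y hy).2, (hq z hz).2] at this
    rwa [NNReal.coe_one, one_mul, Real.dist_eq, dist_eq_norm]
  -- The extension to all of ℝᵏ makes Rademacher's theorem applicable, however irregular A is.
  obtain ⟨g, hg, hgq⟩ := hlip.extend_real
  refine ⟨g, hg, fun x hx => ?_⟩
  have hmem : diagProj k x ∈ diagProj k '' A := ⟨x, hx, rfl⟩
  rw [← hgq hmem]
  have := habs _ (hq _ hmem).1 _ hx
  rw [(hq _ hmem).2, sub_self, norm_zero] at this
  exact sub_eq_zero.1 (abs_nonpos_iff.1 this)

end AntichainChart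

/-! ### Projections of disjoint pieces of an antichain -/

section AntichainProjection

variable {k : ℕ}

/-- Superlevel sets are lower sets, hence order-connected, hence null-measurable. -/
theorem aemeasurable_of_antitone_pi {ι : Type*} [Fintype ι] {u : (ι → ℝ) → ℝ} (hu : Antitone u) :
    AEMeasurable u volume := by
  have : NullMeasurable u volume := by
    refine @measurable_of_Ioi ℝ (NullMeasurableSpace (ι → ℝ) volume) _ _ _ _ _ _ _ _ fun a => ?_
    have hl : IsLowerSet (u ⁻¹' Set.Ioi a) := fun x y hyx hx => lt_of_lt_of_le hx (hu hyx)
    exact hl.ordConnected.nullMeasurableSet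
  exact this.aemeasurable

/-- Almost everywhere, an antichain in the unit cube is the graph of a measurable function over any
coordinate hyperplane. -/
theorem exists_measurable_ae_eq_of_antichain {A : Set (EuclideanSpace ℝ (Fin (k + 1)))}
    (hA : IsCoordAntichain A) (hc : A ⊆ unitCube (k + 1)) (i : Fin (k + 1)) :
    ∃ v : EuclideanSpace ℝ (Fin k) → ℝ, Measurable v ∧
      ∀ᵐ z, ∀ x ∈ A, dropCoord i x = z → x i = v z := by
  -- Taking the supremum of heights over all points of A dominating z gives an antitone function
  -- whatever A is. On A it returns x i, since a higher dominating point would be comparable to x.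
  let F : (Fin k → ℝ) → Set ℝ := fun z => {t | ∃ x ∈ A, (∀ j, z j ≤ x (i.succAbove j)) ∧ x i = t}
  have hbdd : ∀ z, BddAbove (F z) := fun z => ⟨1, by
    rintro t ⟨x, hx, -, rfl⟩
    exact (hc hx i).2⟩
  have hnn : ∀ z, ∀ t ∈ F z, 0 ≤ t := by
    rintro z t ⟨x, hx, -, rfl⟩
    exact (hc hx i).1
  let u : (Fin k → ℝ) → ℝ := fun z => sSup (F z)
  have hu : Antitone u := by
    intro z w hzw
    -- Where `F w` is empty the supremum is 0, which is harmless because heights are nonnegative.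
    refine Real.sSup_le (fun t ht => ?_) (Real.sSup_nonneg (hnn z))
    obtain ⟨x, hx, hw, rfl⟩ := ht
    exact le_csSup (hbdd z) ⟨x, hx, fun j => (hzw j).trans (hw j), rfl⟩
  have hux : ∀ x ∈ A, x i = u fun j => x (i.succAbove j) := by
    intro x hx
    refine le_antisymm (le_csSup (hbdd _) ⟨x, hx, fun j => le_rfl, rfl⟩)
      (Real.sSup_le ?_ (hc hx i).1)
    rintro t ⟨y, hy, hle, rfl⟩
    by_contra! hlt
    refine hA hx hy (fun h => hlt.ne (by rw [h])) fun j => ?_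
    rcases eq_or_ne j i with rfl | hj
    · exact hlt.le
    · obtain ⟨l, rfl⟩ := Fin.exists_succAbove_eq hj
      exact hle l
  have hm : AEMeasurable (fun z : EuclideanSpace ℝ (Fin k) => u (WithLp.ofLp z)) volume :=
    (aemeasurable_of_antitone_pi hu).comp_quasiMeasurePreserving
      (PiLp.volume_preserving_ofLp (Fin k)).quasiMeasurePreserving
  refine ⟨hm.mk _, hm.measurable_mk, hm.ae_eq_mk.mono fun z hz x hx hxz => ?_⟩
  rw [← hz, hux x hx, ← hxz]
  rfl

theorem volume_unitCube (k : ℕ) : volume (unitCube k) = 1 := by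
  have h := volume_setOf_forall_mem (k := k) (Set.Icc 0 1) measurableSet_Icc
  rwa [Real.volume_Icc, sub_zero, ENNReal.ofReal_one, one_pow] at h

/-- The projected pieces may be nonmeasurable, but up to null sets they lie in the preimages of the
T n under the graph map Ψ, which are measurable and disjoint. -/
theorem tsum_volume_dropCoord_image_le_one {A : Set (EuclideanSpace ℝ (Fin (k + 1)))}
    (hA : IsCoordAntichain A) (hc : A ⊆ unitCube (k + 1)) (i : Fin (k + 1))
    {T : ℕ → Set (EuclideanSpace ℝ (Fin (k + 1)))} (hT : ∀ n, MeasurableSet (T n))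
    (hd : Pairwise (Function.onFun Disjoint T)) :
    ∑' n, volume (dropCoord i '' (A ∩ T n)) ≤ 1 := by
  obtain ⟨v, hv, hAv⟩ := exists_measurable_ae_eq_of_antichain hA hc i
  let Ψ : EuclideanSpace ℝ (Fin k) → EuclideanSpace ℝ (Fin (k + 1)) :=
    fun z => WithLp.toLp 2 (i.insertNth (v z) (WithLp.ofLp z))
  have hΨ : Measurable Ψ := by
    refine (PiLp.volume_preserving_toLp (Fin (k + 1))).measurable.comp
      (measurable_pi_lambda _ fun j => ?_)
    refine Fin.succAboveCases i ?_ (fun l => ?_) j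
    · simpa using hv
    · simp only [Fin.insertNth_apply_succAbove]
      fun_prop
  have hQm : MeasurableSet (unitCube k) := measurableSet_setOf_forall_mem id measurableSet_Icc
  have hle : ∀ n, volume (dropCoord i '' (A ∩ T n)) ≤ volume (unitCube k ∩ Ψ ⁻¹' T n) := by
    intro n
    refine measure_mono_ae (hAv.mono fun z hz hzA => ?_)
    obtain ⟨x, ⟨hxA, hxT⟩, rfl⟩ := hzA
    refine ⟨fun j => hc hxA _, ?_⟩
    have : Ψ (dropCoord i x) = x := by
      ext j
      refine Fin.succAboveCases i ?_ (fun l => ?_) j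
      · simp [Ψ, hz x hxA rfl]
      · simp [Ψ]
    rwa [Set.mem_preimage, this]
  calc _ ≤ ∑' n, volume (unitCube k ∩ Ψ ⁻¹' T n) := ENNReal.tsum_le_tsum hle
    _ = volume (⋃ n, unitCube k ∩ Ψ ⁻¹' T n) :=
        (measure_iUnion (fun a b hab => ((hd hab).preimage Ψ).mono Set.inter_subset_right
          Set.inter_subset_right) fun n => hQm.inter (hΨ (hT n))).symm
    _ ≤ volume (unitCube k) := measure_mono (Set.iUnion_subset fun n => Set.inter_subset_left)
    _ = 1 := volume_unitCube k

end AntichainProjection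

/-! ### The linear case: 1 ≤ ∑ |ν i| -/

section Jacobian

variable {k : ℕ}

theorem exists_norm_eq_one_forall_inner_eq_zero
    (T : EuclideanSpace ℝ (Fin k) →ₗᵢ[ℝ] EuclideanSpace ℝ (Fin (k + 1))) :
    ∃ ν : EuclideanSpace ℝ (Fin (k + 1)), ‖ν‖ = 1 ∧ ∀ y, inner ℝ ν (T y) = 0 := by
  have hne : (LinearMap.range T.toLinearMap)ᗮ ≠ ⊥ := by
    intro h
    rw [Submodule.orthogonal_eq_bot_iff] at h
    have h1 := LinearMap.finrank_range_of_inj (f := T.toLinearMap) T.injective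
    rw [h, finrank_top, finrank_euclideanSpace_fin, finrank_euclideanSpace_fin] at h1
    omega
  obtain ⟨w, hw, hw0⟩ := Submodule.exists_mem_ne_zero_of_ne_bot hne
  refine ⟨(‖w‖⁻¹ : ℝ) • w, norm_smul_inv_norm hw0, fun y => ?_⟩
  have h : inner ℝ w (T y) = 0 :=
    Submodule.inner_left_of_mem_orthogonal (LinearMap.mem_range_self T.toLinearMap y) hw
  rw [inner_smul_left, h, mul_zero]

theorem det_eq_det_basisFun (f : EuclideanSpace ℝ (Fin k) →L[ℝ] EuclideanSpace ℝ (Fin k)) :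
    f.det = (Matrix.of fun a b => f (EuclideanSpace.basisFun (Fin k) ℝ b) a).det := by
  rw [ContinuousLinearMap.det, ← LinearMap.det_toMatrix (EuclideanSpace.basisFun (Fin k) ℝ).toBasis]
  congr 1
  ext a b
  simp [LinearMap.toMatrix_apply]

/-- Adjoin a unit normal ν as first column to get an orthogonal matrix. Expanding its determinant ±1
along ν gives the projected determinants with coefficients ±ν i, and |ν i| ≤ 1. -/
theorem one_le_sum_abs_det_dropCoord
    (T : EuclideanSpace ℝ (Fin k) →ₗᵢ[ℝ] EuclideanSpace ℝ (Fin (k + 1))) :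
    1 ≤ ∑ i, |((dropCoord i).comp T.toContinuousLinearMap).det| := by
  obtain ⟨ν, hν, hνT⟩ := exists_norm_eq_one_forall_inner_eq_zero T
  let b := EuclideanSpace.basisFun (Fin k) ℝ
  let w : Fin (k + 1) → EuclideanSpace ℝ (Fin (k + 1)) := Fin.cons ν fun j => T (b j)
  have hw : Orthonormal ℝ w := by
    rw [orthonormal_iff_ite]
    intro a c
    refine Fin.cases ?_ (fun a => ?_) a <;> refine Fin.cases ?_ (fun c => ?_) c
    · simp [w, hν]
    · simp [w, hνT, (Fin.succ_ne_zero c).symm]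
    · simp only [w, Fin.cons_succ, Fin.cons_zero, real_inner_comm ν, hνT, Fin.succ_ne_zero, if_false]
    · simp only [w, Fin.cons_succ, T.inner_map_map, Fin.succ_inj]
      exact orthonormal_iff_ite.1 b.orthonormal a c
  let Q : Matrix (Fin (k + 1)) (Fin (k + 1)) ℝ := Matrix.of fun a c => w c a
  have hQ : Q.transpose * Q = 1 := by
    ext a c
    rw [Matrix.mul_apply, Matrix.one_apply, ← orthonormal_iff_ite.1 hw a c, PiLp.inner_apply]
    refine Finset.sum_congr rfl fun i _ => ?_
    simp [Q, mul_comm]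
  have hdet : |Q.det| = 1 := by
    have h := congrArg Matrix.det hQ
    rw [Matrix.det_mul, Matrix.det_transpose, Matrix.det_one] at h
    have h2 : |Q.det| * |Q.det| = 1 := by rw [← abs_mul, h, abs_one]
    nlinarith [abs_nonneg Q.det]
  rw [← hdet, Matrix.det_succ_column_zero]
  refine (Finset.abs_sum_le_sum_abs _ _).trans (Finset.sum_le_sum fun i _ => ?_)
  rw [abs_mul, abs_mul, abs_pow, abs_neg, abs_one, one_pow, one_mul]
  have h1 : |Q i 0| ≤ 1 := by
    have := PiLp.norm_apply_le ν i
    rwa [hν, Real.norm_eq_abs] at this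
  have h2 : (Q.submatrix i.succAbove Fin.succ).det
      = ((dropCoord i).comp T.toContinuousLinearMap).det := by
    rw [det_eq_det_basisFun]
    rfl
  rw [h2]
  exact mul_le_of_le_one_left (abs_nonneg _) h1

/-- The Hausdorff measure of a flat piece of hypersurface is at most the sum of the volumes of its
coordinate projections. -/
theorem normHausdorff_linear_image_le
    {M : EuclideanSpace ℝ (Fin k) →L[ℝ] EuclideanSpace ℝ (Fin (k + 1))}
    (hM : Function.Injective M) (S : Set (EuclideanSpace ℝ (Fin k))) :
    normHausdorff k (M '' S)
      ≤ ENNReal.ofReal (∑ i, |((dropCoord i).comp M).det|) * volume S := by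
  -- Factor M as an isometric embedding T after an endomorphism B of ℝᵏ; both sides then scale by
  -- |det B|.
  let P := LinearMap.range M.toLinearMap
  have hP : Module.finrank ℝ P = k := by
    rw [LinearMap.finrank_range_of_inj hM, finrank_euclideanSpace_fin]
  let e : P ≃ₗᵢ[ℝ] EuclideanSpace ℝ (Fin k) :=
    ((stdOrthonormalBasis ℝ P).reindex (finCongr hP)).repr
  let T : EuclideanSpace ℝ (Fin k) →ₗᵢ[ℝ] EuclideanSpace ℝ (Fin (k + 1)) :=
    P.subtypeₗᵢ.comp e.symm.toLinearIsometry
  let B : EuclideanSpace ℝ (Fin k) →L[ℝ] EuclideanSpace ℝ (Fin k) :=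
    LinearMap.toContinuousLinearMap (e.toLinearEquiv.toLinearMap ∘ₗ M.toLinearMap.rangeRestrict)
  have hTB : M = T.toContinuousLinearMap.comp B := by
    ext1 y
    simp [T, B]
  have hS : M '' S = T '' (B '' S) := by
    rw [Set.image_image, hTB]
    rfl
  have hsum : ∑ i, |((dropCoord i).comp M).det|
      = (∑ i, |((dropCoord i).comp T.toContinuousLinearMap).det|) * |B.det| := by
    rw [Finset.sum_mul]
    refine Finset.sum_congr rfl fun i _ => ?_
    rw [← abs_mul, hTB]
    congr 1
    exact LinearMap.det_comp ((dropCoord i).comp T.toContinuousLinearMap).toLinearMap B.toLinearMap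
  rw [hS, normHausdorff_isometry_image (Nat.cast_nonneg k) T.isometry, normHausdorff_eq_volume,
    Measure.addHaar_image_continuousLinearMap, hsum]
  gcongr
  exact le_mul_of_one_le_left (abs_nonneg _) (one_le_sum_abs_det_dropCoord T)

end Jacobian

/-! ### Nearly flat pieces -/

section ApproximatesLinear

variable {k : ℕ}

open Filter Topology NNReal

/-- An injective M is antilipschitz with some constant K, so Φ ∘ M⁻¹ is (1 + δK)-Lipschitz on M ''
S; the factor (1 + δK) ^ k tends to 1 as δ → 0. -/
theorem eventually_normHausdorff_image_le
    {M : EuclideanSpace ℝ (Fin k) →L[ℝ] EuclideanSpace ℝ (Fin (k + 1))}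
    (hM : Function.Injective M) {ε : ℝ} (hε : 0 < ε) :
    ∀ᶠ δ in 𝓝[>] (0 : ℝ≥0), ∀ (S : Set (EuclideanSpace ℝ (Fin k)))
      (Φ : EuclideanSpace ℝ (Fin k) → EuclideanSpace ℝ (Fin (k + 1))),
      ApproximatesLinearOn Φ M S δ →
        normHausdorff k (Φ '' S)
          ≤ ENNReal.ofReal ((∑ i, |((dropCoord i).comp M).det|) + ε) * volume S := by
  obtain ⟨K, -, hK⟩ := LinearMap.exists_antilipschitzWith M.toLinearMap (LinearMap.ker_eq_bot.2 hM)
  set D := ∑ i, |((dropCoord i).comp M).det| with hD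
  have hlim : Tendsto (fun δ : ℝ≥0 => ((1 + δ * K : ℝ≥0) : ℝ) ^ k * D) (𝓝 0) (𝓝 D) := by
    have : Continuous fun δ : ℝ≥0 => ((1 + δ * K : ℝ≥0) : ℝ) ^ k * D := by fun_prop
    simpa using this.tendsto 0
  have hev := hlim.eventually (eventually_lt_nhds (lt_add_of_pos_right D hε))
  filter_upwards [nhdsWithin_le_nhds hev] with δ hδ S Φ hΦ
  let N := Function.invFun M
  have hN : Function.LeftInverse N M := Function.leftInverse_invFun hM
  have hlip : LipschitzOnWith (1 + δ * K) (Φ ∘ N) (M '' S) := by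
    refine LipschitzOnWith.of_dist_le_mul ?_
    rintro _ ⟨x, hx, rfl⟩ _ ⟨y, hy, rfl⟩
    simp only [Function.comp_apply, hN x, hN y]
    have h1 : ‖Φ x - Φ y - M (x - y)‖ ≤ δ * ‖x - y‖ := hΦ x hx y hy
    have h2 : ‖x - y‖ ≤ K * ‖M (x - y)‖ := by
      have := hK.le_mul_dist x y
      rw [dist_eq_norm, dist_eq_norm] at this
      simpa using this
    have h3 : ‖Φ x - Φ y‖ ≤ ‖Φ x - Φ y - M (x - y)‖ + ‖M (x - y)‖ := by
      simpa using norm_add_le (Φ x - Φ y - M (x - y)) (M (x - y))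
    rw [dist_eq_norm, dist_eq_norm, ← map_sub]
    push_cast
    have h4 : (δ : ℝ) * ‖x - y‖ ≤ δ * (K * ‖M (x - y)‖) := by gcongr
    linarith
  have himg : Φ '' S = (Φ ∘ N) '' (M '' S) := by
    rw [Set.image_image]
    simp only [Function.comp_apply, hN _]
  calc normHausdorff k (Φ '' S)
      ≤ ((1 + δ * K : ℝ≥0) : ℝ≥0∞) ^ (k : ℝ) * normHausdorff k (M '' S) :=
        himg ▸ normHausdorff_image_le (Nat.cast_nonneg k) hlip
    _ ≤ ((1 + δ * K : ℝ≥0) : ℝ≥0∞) ^ (k : ℝ) * (ENNReal.ofReal D * volume S) := by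
        gcongr
        exact normHausdorff_linear_image_le hM S
    _ = ENNReal.ofReal (((1 + δ * K : ℝ≥0) : ℝ) ^ k * D) * volume S := by
        rw [← mul_assoc, ENNReal.ofReal_mul (by positivity), ENNReal.rpow_natCast,
          ENNReal.ofReal_pow (by positivity), ENNReal.ofReal_coe_nnreal]
    _ ≤ _ := by gcongr

theorem eventually_ofReal_abs_det_mul_le {E : Type*} [NormedAddCommGroup E] [NormedSpace ℝ E]
    [FiniteDimensional ℝ E] [MeasurableSpace E] [BorelSpace E] (μ : Measure E) [μ.IsAddHaarMeasure]
    (L : E →L[ℝ] E) {ε : ℝ} (hε : 0 < ε) :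
    ∀ᶠ δ in 𝓝[>] (0 : ℝ≥0), ∀ (S : Set E) (f : E → E), ApproximatesLinearOn f L S δ →
      ENNReal.ofReal |L.det| * μ S ≤ μ (f '' S) + ENNReal.ofReal ε * μ S := by
  rcases eq_or_ne L.det 0 with h0 | h0
  · simp [h0]
  have hlt : ((|L.det| - ε).toNNReal : ℝ≥0∞) < ENNReal.ofReal |L.det| :=
    (ENNReal.ofReal_lt_ofReal_iff (abs_pos.2 h0)).2 (sub_lt_self _ hε)
  filter_upwards [mul_le_addHaar_image_of_lt_det μ L hlt] with δ hδ S f hf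
  calc ENNReal.ofReal |L.det| * μ S
      ≤ (((|L.det| - ε).toNNReal : ℝ≥0∞) + ENNReal.ofReal ε) * μ S := by
        gcongr
        have := ENNReal.ofReal_add_le (p := |L.det| - ε) (q := ε)
        rwa [sub_add_cancel] at this
    _ = ((|L.det| - ε).toNNReal : ℝ≥0∞) * μ S + ENNReal.ofReal ε * μ S := add_mul _ _ _
    _ ≤ _ := by gcongr; exact hδ S f hf

theorem ApproximatesLinearOn.dropCoord_comp {m k : ℕ} (i : Fin (k + 1))
    {Φ : EuclideanSpace ℝ (Fin m) → EuclideanSpace ℝ (Fin (k + 1))}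
    {M : EuclideanSpace ℝ (Fin m) →L[ℝ] EuclideanSpace ℝ (Fin (k + 1))}
    {S : Set (EuclideanSpace ℝ (Fin m))} {δ : ℝ≥0} (h : ApproximatesLinearOn Φ M S δ) :
    ApproximatesLinearOn (dropCoord i ∘ Φ) ((dropCoord i).comp M) S δ := by
  intro x hx y hy
  refine le_trans ?_ (h x hx y hy)
  simp only [Function.comp_apply, ContinuousLinearMap.comp_apply, ← map_sub]
  exact norm_dropCoord_le i _

/-- A sufficiently flat piece of hypersurface satisfies the projection inequality up to a small
relative error. -/
theorem eventually_normHausdorff_image_le_sum_volume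
    {M : EuclideanSpace ℝ (Fin k) →L[ℝ] EuclideanSpace ℝ (Fin (k + 1))}
    (hM : Function.Injective M) {ε : ℝ} (hε : 0 < ε) :
    ∀ᶠ δ in 𝓝[>] (0 : ℝ≥0), ∀ (S : Set (EuclideanSpace ℝ (Fin k)))
      (Φ : EuclideanSpace ℝ (Fin k) → EuclideanSpace ℝ (Fin (k + 1))),
      ApproximatesLinearOn Φ M S δ →
        normHausdorff k (Φ '' S) ≤ ∑ i, volume (dropCoord i '' (Φ '' S))
          + (k + 2) * ENNReal.ofReal ε * volume S := by
  have h2 : ∀ᶠ δ in 𝓝[>] (0 : ℝ≥0), ∀ i, ∀ (S : Set (EuclideanSpace ℝ (Fin k)))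
      (f : EuclideanSpace ℝ (Fin k) → EuclideanSpace ℝ (Fin k)),
      ApproximatesLinearOn f ((dropCoord i).comp M) S δ →
      ENNReal.ofReal |((dropCoord i).comp M).det| * volume S
        ≤ volume (f '' S) + ENNReal.ofReal ε * volume S :=
    eventually_all.2 fun i => eventually_ofReal_abs_det_mul_le volume _ hε
  -- The factor k + 2 counts one ε from the Hausdorff bound and one from each of the k + 1
  -- projections.
  filter_upwards [eventually_normHausdorff_image_le hM hε, h2] with δ h1 h2 S Φ hΦ
  calc normHausdorff k (Φ '' S)
      ≤ ENNReal.ofReal ((∑ i, |((dropCoord i).comp M).det|) + ε) * volume S := h1 S Φ hΦ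
    _ = ∑ i, ENNReal.ofReal |((dropCoord i).comp M).det| * volume S
          + ENNReal.ofReal ε * volume S := by
        rw [ENNReal.ofReal_add (Finset.sum_nonneg fun i _ => abs_nonneg _) hε.le,
          ENNReal.ofReal_sum_of_nonneg fun i _ => abs_nonneg _, add_mul, Finset.sum_mul]
    _ ≤ ∑ i, (volume (dropCoord i '' (Φ '' S)) + ENNReal.ofReal ε * volume S)
          + ENNReal.ofReal ε * volume S := by
        gcongr with i
        rw [← Set.image_comp]
        exact h2 i S _ (hΦ.dropCoord_comp i)
    _ = _ := by
        rw [Finset.sum_add_distrib, Finset.sum_const, Finset.card_univ, Fintype.card_fin,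
          nsmul_eq_mul]
        push_cast
        ring

end ApproximatesLinear

/-! ### Upper bound for arbitrary antichains -/

section ProjectionInequality

variable {k : ℕ}

open Filter Topology NNReal

theorem isBounded_unitCube (n : ℕ) : Bornology.IsBounded (unitCube n) := by
  refine (Metric.isBounded_closedBall (x := (0 : EuclideanSpace ℝ (Fin n))) (r := √n)).subset
    fun x hx => ?_
  rw [mem_closedBall_zero_iff, EuclideanSpace.norm_eq]
  refine Real.sqrt_le_sqrt ?_
  calc ∑ i, ‖x i‖ ^ 2 ≤ ∑ _i : Fin n, (1 : ℝ) := by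
        refine Finset.sum_le_sum fun i _ => ?_
        rw [Real.norm_eq_abs, sq_abs]
        exact pow_le_one₀ (hx i).1 (hx i).2
    _ = n := by simp

theorem normHausdorff_image_of_volume_eq_zero {n : ℕ} {C : ℝ≥0}
    {Φ : EuclideanSpace ℝ (Fin k) → EuclideanSpace ℝ (Fin n)} (hΦ : LipschitzWith C Φ)
    {N : Set (EuclideanSpace ℝ (Fin k))} (hN : volume N = 0) : normHausdorff k (Φ '' N) = 0 := by
  have h := normHausdorff_image_le (Nat.cast_nonneg k) (hΦ.lipschitzOnWith (s := N))
  rw [normHausdorff_eq_volume, hN, mul_zero] at h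
  exact le_zero_iff.1 h

/-- Differentiating `diagProj k ∘ diagGraph g = id` yields a left inverse of M. -/
theorem injective_of_hasFDerivAt_diagGraph {g : EuclideanSpace ℝ (Fin k) → ℝ}
    {y : EuclideanSpace ℝ (Fin k)}
    {M : EuclideanSpace ℝ (Fin k) →L[ℝ] EuclideanSpace ℝ (Fin (k + 1))}
    (h : HasFDerivAt (diagGraph g) M y) : Function.Injective M := by
  have h1 : HasFDerivAt (diagProj k ∘ diagGraph g) ((diagProj k).comp M) y :=
    (diagProj k).hasFDerivAt.comp y h
  have h2 : diagProj k ∘ diagGraph g = id := funext (diagProj_diagGraph g)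
  rw [h2] at h1
  have h3 := h1.unique (hasFDerivAt_id y)
  exact Function.LeftInverse.injective (g := diagProj k) fun z => congrArg (fun L => L z) h3

/-- Up to an arbitrarily small relative error, an antichain in the unit cube is at most as large as
the sum of its coordinate projections. -/
theorem normHausdorff_antichain_le_add {A : Set (EuclideanSpace ℝ (Fin (k + 1)))}
    (hA : IsCoordAntichain A) (hc : A ⊆ unitCube (k + 1)) {W : Set (EuclideanSpace ℝ (Fin k))}
    (hW : MeasurableSet W) (hAW : diagProj k '' A ⊆ W) {ε : ℝ} (hε : 0 < ε) :
    normHausdorff k A ≤ (k + 1) + (k + 2) * ENNReal.ofReal ε * volume W := by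
  obtain ⟨g, hg, hgA⟩ := exists_lipschitzWith_diagProj_eq hA
  obtain ⟨C, hC⟩ := exists_lipschitzWith_diagGraph hg
  set Φ := diagGraph g with hΦ
  set D := {y | DifferentiableAt ℝ Φ y} with hD
  -- Rademacher's theorem; the Lipschitz image of this null set is negligible.
  have hDc : volume Dᶜ = 0 := hC.ae_differentiableAt
  set Y := diagProj k '' A ∩ D with hY
  have hAY : A ⊆ Φ '' Y ∪ Φ '' Dᶜ := by
    intro x hx
    have hxx : Φ (diagProj k x) = x := diagGraph_diagProj (hgA x hx)
    by_cases h : diagProj k x ∈ D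
    · exact Or.inl ⟨_, ⟨⟨x, hx, rfl⟩, h⟩, hxx⟩
    · exact Or.inr ⟨_, h, hxx⟩
  have hred : normHausdorff k A ≤ normHausdorff k (Φ '' Y) := by
    refine (normHausdorff_mono _ hAY).trans ((normHausdorff_union_le _ _ _).trans_eq ?_)
    rw [normHausdorff_image_of_volume_eq_zero hC hDc, add_zero]
  refine hred.trans ?_
  rcases Y.eq_empty_or_nonempty with hYe | hYne
  · simp [hYe, normHausdorff]
  -- For noninjective M any δ will do: the linear maps occurring in the partition are derivatives of
  -- Φ at points of Y, hence injective.
  have hex : ∀ M : EuclideanSpace ℝ (Fin k) →L[ℝ] EuclideanSpace ℝ (Fin (k + 1)), ∃ δ : ℝ≥0,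
      δ ≠ 0 ∧ (Function.Injective M → ∀ S : Set (EuclideanSpace ℝ (Fin k)),
        ApproximatesLinearOn Φ M S δ →
        normHausdorff k (Φ '' S) ≤ ∑ i, volume (dropCoord i '' (Φ '' S))
          + (k + 2) * ENNReal.ofReal ε * volume S) := by
    intro M
    by_cases hM : Function.Injective M
    · obtain ⟨δ, h1, h2⟩ :=
        ((eventually_normHausdorff_image_le_sum_volume hM hε).and self_mem_nhdsWithin).exists
      exact ⟨δ, ne_of_gt h2, fun _ S hS => h1 S Φ hS⟩
    · exact ⟨1, one_ne_zero, fun h => absurd h hM⟩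
  choose r hr0 hr using hex
  obtain ⟨t, M, htd, htm, hYt, happ, hMf⟩ :=
    exists_partition_approximatesLinearOn_of_hasFDerivWithinAt Φ Y (fderiv ℝ Φ)
      (fun y hy => (DifferentiableAt.hasFDerivAt hy.2).hasFDerivWithinAt) r hr0
  have hMinj : ∀ n, Function.Injective (M n) := by
    intro n
    obtain ⟨y, hy, hMy⟩ := hMf hYne n
    rw [hMy]
    exact injective_of_hasFDerivAt_diagGraph (DifferentiableAt.hasFDerivAt hy.2)
  have hsub : ∀ n, Φ '' (Y ∩ t n) ⊆ A ∩ diagProj k ⁻¹' t n := by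
    rintro n _ ⟨_, ⟨⟨⟨x, hx, rfl⟩, -⟩, ht⟩, rfl⟩
    have hxx : Φ (diagProj k x) = x := diagGraph_diagProj (hgA x hx)
    rw [hxx]
    exact ⟨hx, ht⟩
  have hproj : ∀ i : Fin (k + 1), ∑' n, volume (dropCoord i '' (Φ '' (Y ∩ t n))) ≤ 1 := fun i =>
    (ENNReal.tsum_le_tsum fun n => measure_mono (Set.image_mono (hsub n))).trans
      (tsum_volume_dropCoord_image_le_one hA hc i
        (fun n => (diagProj k).continuous.measurable (htm n))
        fun a b hab => (htd hab).preimage _)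
  -- Y may be nonmeasurable, so countable additivity is applied to the measurable superset W.
  have hvol : ∑' n, volume (Y ∩ t n) ≤ volume W :=
    calc _ ≤ ∑' n, volume (W ∩ t n) := ENNReal.tsum_le_tsum fun n =>
          measure_mono (Set.inter_subset_inter_left _ (Set.inter_subset_left.trans hAW))
      _ = volume (⋃ n, W ∩ t n) := (measure_iUnion (fun a b hab => (htd hab).mono
          Set.inter_subset_right Set.inter_subset_right) fun n => hW.inter (htm n)).symm
      _ ≤ volume W := measure_mono (Set.iUnion_subset fun n => Set.inter_subset_left)
  have hcover : Φ '' Y ⊆ ⋃ n, Φ '' (Y ∩ t n) := by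
    rw [← Set.image_iUnion, ← Set.inter_iUnion, Set.inter_eq_left.2 hYt]
  calc normHausdorff k (Φ '' Y)
      ≤ ∑' n, normHausdorff k (Φ '' (Y ∩ t n)) :=
        (normHausdorff_mono _ hcover).trans (normHausdorff_iUnion_le _ _)
    _ ≤ ∑' n, (∑ i, volume (dropCoord i '' (Φ '' (Y ∩ t n)))
          + (k + 2) * ENNReal.ofReal ε * volume (Y ∩ t n)) :=
        ENNReal.tsum_le_tsum fun n => hr _ (hMinj n) _ (happ n)
    _ = ∑ i, ∑' n, volume (dropCoord i '' (Φ '' (Y ∩ t n)))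
          + (k + 2) * ENNReal.ofReal ε * ∑' n, volume (Y ∩ t n) := by
        rw [ENNReal.tsum_add, ENNReal.tsum_mul_left,
          Summable.tsum_finsetSum fun i _ => ENNReal.summable]
    _ ≤ ∑ _i : Fin (k + 1), 1 + (k + 2) * ENNReal.ofReal ε * volume W := by
        gcongr with i
        exact hproj i
    _ = _ := by simp

theorem normHausdorff_antichain_le {A : Set (EuclideanSpace ℝ (Fin (k + 1)))}
    (hA : IsCoordAntichain A) (hc : A ⊆ unitCube (k + 1)) : normHausdorff k A ≤ k + 1 := by
  have hb : Bornology.IsBounded (diagProj k '' A) :=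
    (diagProj k).lipschitz.isBounded_image ((isBounded_unitCube _).subset hc)
  obtain ⟨R, hR⟩ := hb.subset_closedBall 0
  have hW : volume (Metric.closedBall (0 : EuclideanSpace ℝ (Fin k)) R) ≠ ∞ :=
    measure_closedBall_lt_top.ne
  -- The closed ball has finite volume, so the error vanishes as ε → 0.
  have hlim : Tendsto (fun ε : ℝ => ((k : ℝ≥0∞) + 1) + (k + 2) * ENNReal.ofReal ε
      * volume (Metric.closedBall (0 : EuclideanSpace ℝ (Fin k)) R)) (𝓝[>] 0) (𝓝 (k + 1)) := by
    have h0 : Tendsto (fun ε : ℝ => ENNReal.ofReal ε) (𝓝[>] 0) (𝓝 0) := by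
      simpa using (ENNReal.continuous_ofReal.tendsto 0).mono_left nhdsWithin_le_nhds
    have h1 : ((k : ℝ≥0∞) + 2) ≠ ∞ := by finiteness
    simpa using (ENNReal.Tendsto.mul_const (ENNReal.Tendsto.const_mul h0 (Or.inr h1))
      (Or.inr hW)).const_add ((k : ℝ≥0∞) + 1)
  refine ge_of_tendsto hlim ?_
  filter_upwards [self_mem_nhdsWithin] with ε hε
  exact normHausdorff_antichain_le_add hA hc Metric.isClosed_closedBall.measurableSet hR hε

end ProjectionInequality

/-! ### Conclusion: combining the two bounds -/

theorem corollary1p4 (n : ℕ) (hn : 1 ≤ n) :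
    sSup {h : ENNReal | ∃ A : Set (EuclideanSpace ℝ (Fin n)),
      A ⊆ unitCube n ∧ IsCoordAntichain A ∧ h = normHausdorff ((n : ℝ) - 1) A} = (n : ENNReal) := by
  obtain ⟨k, rfl⟩ := Nat.exists_eq_add_of_le' hn
  have hk : ((k + 1 : ℕ) : ℝ) - 1 = k := by push_cast; ring
  rw [hk]
  push_cast
  refine le_antisymm (sSup_le ?_) ?_
  · rintro _ ⟨A, hc, hA, rfl⟩
    exact normHausdorff_antichain_le hA hc
  · have hlim : Filter.Tendsto (fun ε : ℝ => ((k : ℝ≥0∞) + 1) * ENNReal.ofReal (1 - ε) ^ k)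
        (nhdsWithin 0 (Set.Ioi 0)) (nhds (k + 1)) := by
      have h0 : Filter.Tendsto (fun ε : ℝ => ENNReal.ofReal (1 - ε) ^ k) (nhds 0) (nhds 1) := by
        have : Continuous fun ε : ℝ => ENNReal.ofReal (1 - ε) ^ k :=
          (ENNReal.continuous_pow k).comp
            (ENNReal.continuous_ofReal.comp (continuous_const.sub continuous_id))
        simpa using this.tendsto 0
      have h1 : ((k : ℝ≥0∞) + 1) ≠ ∞ := by finiteness
      simpa using ENNReal.Tendsto.const_mul (h0.mono_left nhdsWithin_le_nhds) (Or.inr h1)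
    refine le_of_tendsto hlim ?_
    filter_upwards [Ioo_mem_nhdsGT one_pos] with ε hε
    refine (le_normHausdorff_iUnion_facetGraph hε.1).trans (le_sSup ?_)
    exact ⟨_, Set.iUnion_subset fun i => facetGraph_subset_unitCube hε.1 hε.2 i,
      isCoordAntichain_iUnion_facetGraph hε.1, rfl⟩
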